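/- Let $G$ be a real reductive Lie group with Lie algebra $\mathfrak g$: $G$ has finitely many connected components and $\mathfrak g=[\mathfrak g,\mathfrak g]\oplus\mathfrak z(\mathfrak g)$ with $[\mathfrak g,\mathfrak g]$ semisimple. Let $\theta$ be a Cartan involution of $G$, with compact fixed point group $K$ and induced decomposition $\mathfrak g=\mathfrak k\oplus\mathfrak p$, so that $K\times\mathfrak p\to G$, $(k,v)\mapsto k\exp v$, is a diffeomorphism. Let $\mathscr M$ be a Hausdorff space with a continuous $G$-action, with stabilizers $G_x$ and their Lie algebras $\mathfrak g_x=\{\xi\in\mathfrak g:\exp(\mathbb R\xi)\subset G_x\}$. Let $\Psi:\mathscr M\times G\to\mathbb R$ be a Kempf–Ness function for $(\mathscr M,G,K)$, i.e. for all $x\in\mathscr M$, $g,h\in G$, $k\in K$, $v\in\mathfrak p$: (P1) $\Psi(x,\cdot)$ is smooth; (P2) $\Psi(x,kg)=\Psi(x,g)$; (P3) $\frac{d^2}{dt^2}\Psi(x,\exp(tv))\ge 0$ for all $t\in\mathbb R$, and $\frac{d^2}{dt^2}\big|_{t=0}\Psi(x,\exp(tv))=0$ if and only if $\exp(\mathbb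 Rv)\subset G_x$; (P4) $\Psi(x,g)+\Psi(gx,h)=\Psi(x,hg)$; (P5) the gradient map $\mathfrak F:\mathscr M\to\mathfrak p^*$, $\langle\mathfrak F(x),v\rangle=\frac{d}{dt}\big|_{t=0}\Psi(x,\exp(tv))$, is continuous. For a subgroup $H\subset G$ with Lie algebra $\mathfrak h$ (for instance $H=G$), a point $y$ is called polystable for $H$ if there is $h\in H$ such that $\mathfrak F(hy)$ vanishes on $\mathfrak h\cap\mathfrak p$; it is called stable for $H$ if moreover $\mathfrak h\cap\mathfrak g_y$ is conjugate, under $\mathrm{Ad}(H)$, to a subalgebra of $\mathfrak h\cap\mathfrak k$. Let $x\in\mathscr M$ be polystable for $G$. Then there exist $g\in G$ and an abelian subalgebra $\mathfrak a\subset\mathfrak p$ with $\mathfrak a\subset\mathfrak g_{gx}$ such that $gx$ is polystable for $$G^{\mathfrak a}=\{h\in G:\ \mathrm{Ad}(h)\xi=\xi\ \text{ for all }\xi\in\mathfrak a\},$$ and such that $gx$ is stable for the semisimple part $G'_{ss}$ of $G^{\mathfrak a}$, i.e. for the analytic subgroup of $G$ with Lie algebra $[\mathfrak g^{\mathfrak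 a},\mathfrak g^{\mathfrak a}]$, where $\mathfrak g^{\mathfrak a}=\{\eta\in\mathfrak g:[\eta,\xi]=0\ \text{ for all }\xi\in\mathfrak a\}$ is the Lie algebra of $G^{\mathfrak a}$. -/

import Mathlib

open scoped Manifold ContDiff

noncomputable section

section LieTheory

variable (n : ℕ) {G : Type*} [TopologicalSpace G] [ChartedSpace (EuclideanSpace ℝ (Fin n)) G]
  [Group G]

/-- A smooth real Lie group is of the class required for its Lie algebra. -/
instance lieGroupMinSmoothness [LieGroup (𝓡 n) ∞ G] : LieGroup (𝓡 n) (minSmoothness ℝ 3) G := by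
  rw [minSmoothness_of_isRCLikeNormedField]
  infer_instance

variable {n}

open Classical in
/-- The exponential map of a Lie group: `exp v = γ 1`, where `γ` is the integral curve of the
left-invariant vector field of `v` with `γ 0 = 1`. (Such a `γ` always exists and is unique.) -/
def lieExp (v : GroupLieAlgebra (𝓡 n) G) : G :=
  if h : ∃ γ : ℝ → G, γ 0 = 1 ∧ IsMIntegralCurve (I := 𝓡 n) γ (mulInvariantVectorField v) then
    h.choose 1
  else 1

variable (n)

/-- The differential at the identity of a group endomorphism of `G`, as an endomorphism of the Lie
algebra (note that `f 1 = 1`). -/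
def lieDifferential (f : G →* G) :
    GroupLieAlgebra (𝓡 n) G →ₗ[ℝ] GroupLieAlgebra (𝓡 n) G :=
  (show EuclideanSpace ℝ (Fin n) →L[ℝ] EuclideanSpace ℝ (Fin n) from
    mfderiv (𝓡 n) (𝓡 n) f 1).toLinearMap

/-- The adjoint representation: `Ad g` is the differential at `1` of `h ↦ g * h * g⁻¹`. -/
def lieAd (g : G) : GroupLieAlgebra (𝓡 n) G →ₗ[ℝ] GroupLieAlgebra (𝓡 n) G :=
  lieDifferential n (MulAut.conj g).toMonoidHom

theorem lieAd_one (ξ : GroupLieAlgebra (𝓡 n) G) : lieAd n (1 : G) ξ = ξ := by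
  have e : ((MulAut.conj (1 : G)).toMonoidHom : G → G) = id := by
    funext y
    simp
  unfold lieAd lieDifferential
  rw [e, mfderiv_id]
  rfl

/-- The subgroup of fixed points of `θ`. -/
def fixedSubgroup (θ : G ≃* G) : Subgroup G where
  carrier := {g | θ g = g}
  mul_mem' := by
    intro a b ha hb
    change θ (a * b) = a * b
    rw [map_mul, show θ a = a from ha, show θ b = b from hb]
  one_mem' := by simp
  inv_mem' := by
    intro a ha
    change θ a⁻¹ = a⁻¹
    rw [map_inv, show θ a = a from ha]

/-- The `1`-eigenspace of the differential of `θ`. -/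
def kPart (θ : G ≃* G) : Submodule ℝ (GroupLieAlgebra (𝓡 n) G) :=
  Module.End.eigenspace (lieDifferential n θ.toMonoidHom) 1

/-- The `-1`-eigenspace of the differential of `θ`. -/
def pPart (θ : G ≃* G) : Submodule ℝ (GroupLieAlgebra (𝓡 n) G) :=
  Module.End.eigenspace (lieDifferential n θ.toMonoidHom) (-1)

variable [LieGroup (𝓡 n) ∞ G]

variable (G) in
/-- Real reductive Lie groups: finitely many connected components, and
`𝔤 = [𝔤, 𝔤] ⊕ 𝔷(𝔤)` with `[𝔤, 𝔤]` semisimple. -/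
structure IsRealReductive : Prop where
  finite_components : Finite (ConnectedComponents G)
  isCompl : IsCompl (LieAlgebra.derivedSeries ℝ (GroupLieAlgebra (𝓡 n) G) 1)
    (LieAlgebra.center ℝ (GroupLieAlgebra (𝓡 n) G))
  isSemisimple : LieAlgebra.IsSemisimple ℝ
    (LieAlgebra.derivedSeries ℝ (GroupLieAlgebra (𝓡 n) G) 1)

/-- `θ` is a (global) Cartan involution of `G`, with fixed point set the compact group `K` and with
`𝔭` the `-1`-eigenspace of its differential. -/
structure IsCartanInvolution (θ : G ≃* G) : Prop where
  smooth : ContMDiff (𝓡 n) (𝓡 n) ∞ θ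
  involutive : ∀ g, θ (θ g) = g
  /-- `θ` induces a Cartan involution of the semisimple algebra `[𝔤, 𝔤]`: the form
  `-B(ξ, θ ξ)`, with `B` the Killing form, is positive definite there. -/
  killing_neg : ∀ ξ ∈ LieAlgebra.derivedSeries ℝ (GroupLieAlgebra (𝓡 n) G) 1, ξ ≠ 0 →
    killingForm ℝ (GroupLieAlgebra (𝓡 n) G) ξ (lieDifferential n θ.toMonoidHom ξ) < 0
  isCompact_fixed : IsCompact (fixedSubgroup θ : Set G)
  /-- `K × 𝔭 → G`, `(k, v) ↦ k exp v` is a diffeomorphism: it is bijective, and the `𝔭`-component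
  `P` of its inverse (hence also the `K`-component `g ↦ g exp (-P g)`) is smooth. -/
  polar : ∃ P : G → EuclideanSpace ℝ (Fin n),
    ContMDiff (𝓡 n) 𝓘(ℝ, EuclideanSpace ℝ (Fin n)) ∞ P ∧
    (∀ g, (P g : GroupLieAlgebra (𝓡 n) G) ∈ pPart n θ ∧
      g * (lieExp (P g : GroupLieAlgebra (𝓡 n) G))⁻¹ ∈ fixedSubgroup θ) ∧
    ∀ k ∈ fixedSubgroup θ, ∀ v ∈ pPart n θ, P (k * lieExp v) = v

theorem lieAd_mul (g h : G) (ξ : GroupLieAlgebra (𝓡 n) G) :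
    lieAd n (g * h) ξ = lieAd n g (lieAd n h ξ) := by
  have smooth : ∀ (a x : G), MDifferentiableAt (𝓡 n) (𝓡 n) (MulAut.conj a).toMonoidHom x := by
    intro a x
    have H : ContMDiff (𝓡 n) (𝓡 n) ∞ (fun y : G => a * y * a⁻¹) :=
      (contMDiff_mul_right (a := a⁻¹)).comp (contMDiff_mul_left (a := a))
    exact (H x).mdifferentiableAt (by simp)
  have e : ((MulAut.conj (g * h)).toMonoidHom : G → G) =
      (MulAut.conj g).toMonoidHom ∘ (MulAut.conj h).toMonoidHom := by
    funext y
    simp [mul_assoc]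
  have h1 : (MulAut.conj h).toMonoidHom (1 : G) = 1 := map_one _
  have key := mfderiv_comp (I := 𝓡 n) (I' := 𝓡 n) (I'' := 𝓡 n) (1 : G)
    (smooth g ((MulAut.conj h).toMonoidHom 1)) (smooth h 1)
  unfold lieAd lieDifferential
  rw [e, key, h1]
  rfl

/-- The centralizer `G^𝔞 = {g : Ad g ξ = ξ for all ξ ∈ 𝔞}`. -/
def groupCentralizer (𝔞 : LieSubalgebra ℝ (GroupLieAlgebra (𝓡 n) G)) : Subgroup G where
  carrier := {g | ∀ ξ ∈ 𝔞, lieAd n g ξ = ξ}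
  mul_mem' := by
    intro g h hg hh ξ hξ
    rw [lieAd_mul, hh ξ hξ, hg ξ hξ]
  one_mem' := fun ξ _ => lieAd_one n ξ
  inv_mem' := by
    intro g hg ξ hξ
    conv_lhs => rw [← hg ξ hξ]
    rw [← lieAd_mul, inv_mul_cancel, lieAd_one]

/-- The Lie algebra `𝔤^𝔞 = {η : [η, ξ] = 0 for all ξ ∈ 𝔞}` of `G^𝔞`. -/
def algebraCentralizer (𝔞 : LieSubalgebra ℝ (GroupLieAlgebra (𝓡 n) G)) :
    LieSubalgebra ℝ (GroupLieAlgebra (𝓡 n) G) where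
  carrier := {η | ∀ ξ ∈ 𝔞, ⁅η, ξ⁆ = 0}
  add_mem' := by
    intro a b ha hb ξ hξ
    rw [add_lie, ha ξ hξ, hb ξ hξ, add_zero]
  zero_mem' := by
    intro ξ _
    exact zero_lie ξ
  smul_mem' := by
    intro c a ha ξ hξ
    rw [smul_lie, ha ξ hξ, smul_zero]
  lie_mem' := by
    intro a b ha hb ξ hξ
    rw [lie_lie, ha ξ hξ, hb ξ hξ, lie_zero, lie_zero, sub_zero]

/-- The derived algebra `[𝔥, 𝔥]` of a subalgebra `𝔥` of `𝔤`, as a subalgebra of `𝔤`. -/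
def derivedSubalgebra (𝔥 : LieSubalgebra ℝ (GroupLieAlgebra (𝓡 n) G)) :
    LieSubalgebra ℝ (GroupLieAlgebra (𝓡 n) G) :=
  LieSubalgebra.map 𝔥.incl (LieAlgebra.derivedSeries ℝ 𝔥 1).toLieSubalgebra

/-- The analytic subgroup of `G` with Lie algebra `𝔥`, i.e. the subgroup generated by `exp 𝔥`. -/
def analyticSubgroup (𝔥 : LieSubalgebra ℝ (GroupLieAlgebra (𝓡 n) G)) : Subgroup G :=
  Subgroup.closure (lieExp '' (𝔥 : Set (GroupLieAlgebra (𝓡 n) G)))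

end LieTheory

section Stability

variable {n : ℕ} {G : Type*} [TopologicalSpace G] [ChartedSpace (EuclideanSpace ℝ (Fin n)) G]
  [Group G] {M : Type*} [TopologicalSpace M] [MulAction G M]

variable (n) in
/-- The pairing `⟨𝔉(x), v⟩ = d/dt Ψ(x, exp (t v))` at `t = 0`, for `v ∈ 𝔭`. -/
def gradientMap (Ψ : M → G → ℝ) (x : M) (v : GroupLieAlgebra (𝓡 n) G) : ℝ :=
  deriv (fun t : ℝ => Ψ x (lieExp (t • v))) 0

variable (G) in
/-- The Lie algebra `𝔤_x` of the stabilizer `G_x`: those `ξ` with `exp (ℝ ξ) ⊆ G_x`. -/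
def stabilizerAlgebra (x : M) : Set (GroupLieAlgebra (𝓡 n) G) :=
  {ξ | ∀ t : ℝ, lieExp (t • ξ) ∈ MulAction.stabilizer G x}

/-- Kempf-Ness functions for `(M, G, K)`, with `K` and `𝔭` given by the Cartan involution `θ`. -/
structure IsKempfNess (θ : G ≃* G) (Ψ : M → G → ℝ) : Prop where
  smooth : ∀ x, ContMDiff (𝓡 n) 𝓘(ℝ, ℝ) ∞ (Ψ x)
  left_invariant : ∀ x, ∀ k ∈ fixedSubgroup θ, ∀ g, Ψ x (k * g) = Ψ x g
  convex : ∀ x, ∀ v ∈ pPart n θ, ∀ t : ℝ,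
    0 ≤ iteratedDeriv 2 (fun s : ℝ => Ψ x (lieExp (s • v))) t
  strict : ∀ x, ∀ v ∈ pPart n θ,
    iteratedDeriv 2 (fun s : ℝ => Ψ x (lieExp (s • v))) 0 = 0 ↔
      ∀ t : ℝ, lieExp (t • v) ∈ MulAction.stabilizer G x
  cocycle : ∀ x g h, Ψ x g + Ψ (g • x) h = Ψ x (h * g)
  /-- Continuity of `𝔉 : M → 𝔭*`; as `𝔭` is finite-dimensional, this is continuity of
  `x ↦ ⟨𝔉(x), v⟩` for every `v ∈ 𝔭`. -/
  continuous_gradientMap : ∀ v ∈ pPart n θ, Continuous (fun x => gradientMap n Ψ x v)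

variable [LieGroup (𝓡 n) ∞ G]

/-- `x` is polystable for the subgroup `H` of `G` with Lie algebra `𝔥`, with respect to the
restriction of `Ψ` to `M × H`: the orbit `H x` meets the zero set of the gradient map of `H`, which
is `y ↦ 𝔉(y)` restricted to `𝔥 ∩ 𝔭`. -/
def IsPolystable (θ : G ≃* G) (Ψ : M → G → ℝ) (H : Subgroup G)
    (𝔥 : LieSubalgebra ℝ (GroupLieAlgebra (𝓡 n) G)) (x : M) : Prop :=
  ∃ h ∈ H, ∀ v ∈ 𝔥, v ∈ pPart n θ → gradientMap n Ψ (h • x) v = 0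

/-- `x` is stable for the subgroup `H` of `G` with Lie algebra `𝔥`: it is polystable for `H`, and
the stabilizer algebra `𝔥_x = 𝔥 ∩ 𝔤_x` is conjugate in `H` to a subalgebra of `𝔥 ∩ 𝔨`. -/
def IsStable (θ : G ≃* G) (Ψ : M → G → ℝ) (H : Subgroup G)
    (𝔥 : LieSubalgebra ℝ (GroupLieAlgebra (𝓡 n) G)) (x : M) : Prop :=
  IsPolystable θ Ψ H 𝔥 x ∧
    ∃ h ∈ H, ∀ ξ ∈ 𝔥, ξ ∈ stabilizerAlgebra G x → lieAd n h ξ ∈ 𝔥 ∧ lieAd n h ξ ∈ kPart n θ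

end Stability

end

open scoped Manifold ContDiff

/-! ### One-parameter groups and their behaviour under homomorphisms -/

section Exponential

open VectorField

variable {n : ℕ} {G : Type*} [TopologicalSpace G] [ChartedSpace (EuclideanSpace ℝ (Fin n)) G]
  [Group G]

/-! Move `x` within its orbit to a zero `y = g • x` of the gradient map, and let `𝔞` be a maximal
abelian subspace of `𝔭_y = 𝔭 ∩ 𝔤_y`. Polystability of `y` for every subgroup is then immediate; the
content is that `[𝔤^𝔞, 𝔤^𝔞] ∩ 𝔤_y` lies in `𝔨`.

Let `ξ` be in this intersection and let `b` be its `𝔭`-component. Since `𝔤^𝔞` is `θ`-stable, `b ∈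
[𝔤^𝔞, 𝔤^𝔞]`; since `y` is a zero of the gradient map, `b ∈ 𝔤_y`
(`IsKempfNess.half_sub_mem_stabilizerAlgebra`). So `b` lies in `𝔭_y` and commutes with `𝔞`, whence
`b ∈ 𝔞` by maximality. But `𝔞` is Killing-orthogonal to `[𝔤^𝔞, 𝔤^𝔞]`, so `b` is orthogonal to
itself, while the Killing form is definite on `𝔭 ∩ [𝔤, 𝔤]`. Hence `b = 0`.

The two facts on `𝔭_y` (it is a subspace, and it contains the `𝔭`-components of `𝔤_y`) come from the
Hessian at `1` of `φ(g) = Ψ(y, g⁻¹)`. By (P3) this form is nonnegative on `𝔭`, and `𝔭_y` is the set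
of its isotropic vectors there. The inverse turns left `K`-invariance into right `K`-invariance,
which suits left-invariant vector fields. -/

theorem mulInvariantVectorField_one (v : GroupLieAlgebra (𝓡 n) G) :
    mulInvariantVectorField v (1 : G) = v := by
  have e : ((1 : G) * ·) = id := funext one_mul
  unfold mulInvariantVectorField
  rw [e, mfderiv_id]
  rfl

theorem IsMIntegralCurve.map {γ : ℝ → G} {f : G → G} {v w : GroupLieAlgebra (𝓡 n) G}
    (hγ : IsMIntegralCurve (I := 𝓡 n) γ (mulInvariantVectorField v))
    (hf : MDifferentiable (𝓡 n) (𝓡 n) f)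
    (h : ∀ g, mfderiv (𝓡 n) (𝓡 n) f g (mulInvariantVectorField v g) =
      mulInvariantVectorField w (f g)) :
    IsMIntegralCurve (I := 𝓡 n) (f ∘ γ) (mulInvariantVectorField w) := by
  intro t
  have := (hf (γ t)).hasMFDerivAt.comp t (hγ t)
  refine this.congr_mfderiv ?_
  ext
  exact (map_smul _ _ _).trans (congrArg _ (h (γ t)))

variable [LieGroup (𝓡 n) ∞ G]

theorem mdifferentiable_leftTranslation (a : G) : MDifferentiable (𝓡 n) (𝓡 n) (a * ·) :=
  (contMDiff_mul_left (I := 𝓡 n) (n := ∞) (a := a)).mdifferentiable (by simp)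

theorem mdifferentiable_conj (a : G) :
    MDifferentiable (𝓡 n) (𝓡 n) (MulAut.conj a).toMonoidHom :=
  ((contMDiff_mul_right (I := 𝓡 n) (n := ∞) (a := a⁻¹)).comp
    (contMDiff_mul_left (a := a))).mdifferentiable (by simp)

theorem contMDiff_one_mulInvariantVectorField (v : GroupLieAlgebra (𝓡 n) G) :
    ContMDiff (𝓡 n) (𝓡 n).tangent 1
      (fun g : G => (⟨g, mulInvariantVectorField v g⟩ : TangentBundle (𝓡 n) G)) :=
  (contMDiff_mulInvariantVectorField v).of_le (le_minSmoothness.trans' (by norm_num))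

/-- A smooth homomorphism intertwines left-invariant vector fields. -/
theorem mfderiv_mulInvariantVectorField (f : G →* G) (hf : MDifferentiable (𝓡 n) (𝓡 n) f)
    (v : GroupLieAlgebra (𝓡 n) G) (g : G) :
    mfderiv (𝓡 n) (𝓡 n) f g (mulInvariantVectorField v g) =
      mulInvariantVectorField (lieDifferential n f v) (f g) := by
  have e : (f ∘ (g * ·) : G → G) = (f g * ·) ∘ f := by
    funext h
    simp
  have h1 := mfderiv_comp_apply (I := 𝓡 n) (I' := 𝓡 n) (I'' := 𝓡 n) (1 : G)
    (g := f) (f := (g * ·)) (hf _) (mdifferentiable_leftTranslation g 1) v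
  have h2 := mfderiv_comp_apply (I := 𝓡 n) (I' := 𝓡 n) (I'' := 𝓡 n) (1 : G)
    (g := (f g * ·)) (f := f) (mdifferentiable_leftTranslation (f g) _) (hf 1) v
  rw [e, h2] at h1
  rw [mul_one, map_one] at h1
  exact h1.symm

/-- Left translations preserve left-invariant vector fields. -/
theorem mfderiv_mul_left_mulInvariantVectorField (v : GroupLieAlgebra (𝓡 n) G) (a g : G) :
    mfderiv (𝓡 n) (𝓡 n) (a * ·) g (mulInvariantVectorField v g) =
      mulInvariantVectorField v (a * g) := by
  have e : ((a * g) * · : G → G) = (a * ·) ∘ (g * ·) := by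
    funext h
    simp [mul_assoc]
  have h1 := mfderiv_comp_apply (I := 𝓡 n) (I' := 𝓡 n) (I'' := 𝓡 n) (1 : G)
    (g := (a * ·)) (f := (g * ·)) (mdifferentiable_leftTranslation a _) (mdifferentiable_leftTranslation g 1) v
  rw [← e] at h1
  rw [mul_one] at h1
  exact h1.symm

variable [T2Space G]

theorem exists_isMIntegralCurve_mulInvariantVectorField (v : GroupLieAlgebra (𝓡 n) G) :
    ∃ γ : ℝ → G, γ 0 = 1 ∧ IsMIntegralCurve (I := 𝓡 n) γ (mulInvariantVectorField v) := by
  obtain ⟨γ, h0, hγ⟩ := exists_isMIntegralCurveAt_of_contMDiffAt_boundaryless (I := 𝓡 n) 0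
    (contMDiff_one_mulInvariantVectorField v (1 : G))
  obtain ⟨ε, hε, hγ⟩ := isMIntegralCurveAt_iff'.1 hγ
  -- Left translates of one local curve through `1` give curves through every point with the same
  -- lifetime `ε`, so the field is complete.
  refine exists_isMIntegralCurve_of_isMIntegralCurveOn (I := 𝓡 n)
    (contMDiff_one_mulInvariantVectorField v) hε (fun g => ⟨(g * ·) ∘ γ, by simp [h0], ?_⟩) 1
  intro t ht
  rw [Real.ball_eq_Ioo, zero_sub, zero_add] at hγ
  have := ((mdifferentiable_leftTranslation g (γ t)).hasMFDerivAt).comp_hasMFDerivWithinAt t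
    (hγ t ht)
  refine this.congr_mfderiv ?_
  ext
  exact (map_smul _ _ _).trans (congrArg _ (mfderiv_mul_left_mulInvariantVectorField v g (γ t)))

theorem isMIntegralCurve_unique {γ γ' : ℝ → G} {v : GroupLieAlgebra (𝓡 n) G}
    (hγ : IsMIntegralCurve (I := 𝓡 n) γ (mulInvariantVectorField v))
    (hγ' : IsMIntegralCurve (I := 𝓡 n) γ' (mulInvariantVectorField v)) (h : γ 0 = γ' 0) :
    γ = γ' :=
  isMIntegralCurve_Ioo_eq_of_contMDiff_boundaryless
    (contMDiff_one_mulInvariantVectorField v) hγ hγ' h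

theorem lieExp_eq_of_isMIntegralCurve {γ : ℝ → G} {v : GroupLieAlgebra (𝓡 n) G} (h0 : γ 0 = 1)
    (hγ : IsMIntegralCurve (I := 𝓡 n) γ (mulInvariantVectorField v)) (t : ℝ) :
    lieExp (t • v) = γ t := by
  have hs : IsMIntegralCurve (I := 𝓡 n) (γ ∘ (· * t)) (mulInvariantVectorField (t • v)) := by
    rw [mulInvariantVectorField_smul]
    exact hγ.comp_mul t
  have hex : ∃ γ : ℝ → G, γ 0 = 1 ∧
      IsMIntegralCurve (I := 𝓡 n) γ (mulInvariantVectorField (t • v)) :=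
    ⟨_, by simp [h0], hs⟩
  unfold lieExp
  rw [dif_pos hex]
  have := isMIntegralCurve_unique hex.choose_spec.2 hs (by simp [h0, hex.choose_spec.1])
  rw [this]
  simp

theorem isMIntegralCurve_lieExp (v : GroupLieAlgebra (𝓡 n) G) :
    IsMIntegralCurve (I := 𝓡 n) (fun t : ℝ => (lieExp (t • v) : G)) (mulInvariantVectorField v) := by
  obtain ⟨γ, h0, hγ⟩ := exists_isMIntegralCurve_mulInvariantVectorField v
  have : (fun t : ℝ => (lieExp (t • v) : G)) = γ := funext (lieExp_eq_of_isMIntegralCurve h0 hγ)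
  rwa [this]

theorem lieExp_zero : (lieExp (0 : GroupLieAlgebra (𝓡 n) G) : G) = 1 := by
  obtain ⟨γ, h0, hγ⟩ :=
    exists_isMIntegralCurve_mulInvariantVectorField (0 : GroupLieAlgebra (𝓡 n) G)
  rw [← zero_smul ℝ (0 : GroupLieAlgebra (𝓡 n) G), lieExp_eq_of_isMIntegralCurve h0 hγ, h0]

theorem map_lieExp (f : G →* G) (hf : MDifferentiable (𝓡 n) (𝓡 n) f)
    (v : GroupLieAlgebra (𝓡 n) G) (t : ℝ) :
    f (lieExp (t • v)) = lieExp (t • lieDifferential n f v) :=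
  (lieExp_eq_of_isMIntegralCurve (γ := f ∘ fun t : ℝ => lieExp (t • v))
    (by simp [lieExp_zero]) ((isMIntegralCurve_lieExp v).map hf
      (mfderiv_mulInvariantVectorField f hf v)) t).symm

theorem lieExp_add_smul (v : GroupLieAlgebra (𝓡 n) G) (s t : ℝ) :
    (lieExp ((s + t) • v) : G) = lieExp (s • v) * lieExp (t • v) := by
  have h := isMIntegralCurve_unique ((isMIntegralCurve_lieExp v).comp_add s)
    ((isMIntegralCurve_lieExp v).map (mdifferentiable_leftTranslation (lieExp (s • v)))
      (fun g => mfderiv_mul_left_mulInvariantVectorField v _ g)) (by simp [lieExp_zero])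
  have := congrFun h t
  simpa [add_comm] using this

theorem lieExp_neg_smul (v : GroupLieAlgebra (𝓡 n) G) (t : ℝ) :
    (lieExp ((-t) • v) : G) = (lieExp (t • v))⁻¹ := by
  rw [eq_inv_iff_mul_eq_one, ← lieExp_add_smul, neg_add_cancel, zero_smul, lieExp_zero]

end Exponential

/-! ### The differential of an involution as a Lie algebra automorphism -/

section CartanDecomposition

open VectorField

variable {n : ℕ} {G : Type*} [TopologicalSpace G] [ChartedSpace (EuclideanSpace ℝ (Fin n)) G]
  [Group G]

/-- The differential of an involution is an involution. -/
theorem lieDifferential_involutive (θ : G ≃* G) (hs : MDifferentiable (𝓡 n) (𝓡 n) θ)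
    (hθ : ∀ g, θ (θ g) = g) (ξ : GroupLieAlgebra (𝓡 n) G) :
    lieDifferential n θ.toMonoidHom (lieDifferential n θ.toMonoidHom ξ) = ξ := by
  have e : (θ ∘ θ : G → G) = id := funext hθ
  have h := mfderiv_comp_apply (I := 𝓡 n) (I' := 𝓡 n) (I'' := 𝓡 n) (1 : G)
    (g := θ) (f := θ) (hs _) (hs 1) ξ
  rw [e, mfderiv_id, map_one] at h
  exact h.symm

variable [LieGroup (𝓡 n) ∞ G]

/-- The differential of a smooth involutive automorphism is a Lie algebra homomorphism. -/
theorem lieDifferential_lie (θ : G ≃* G) (hs : ContMDiff (𝓡 n) (𝓡 n) ∞ θ)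
    (hθ : ∀ g, θ (θ g) = g) (v w : GroupLieAlgebra (𝓡 n) G) :
    lieDifferential n θ.toMonoidHom ⁅v, w⁆ =
      ⁅lieDifferential n θ.toMonoidHom v, lieDifferential n θ.toMonoidHom w⁆ := by
  have hd : MDifferentiable (𝓡 n) (𝓡 n) θ := hs.mdifferentiable (by simp)
  -- As `θ` is its own inverse, pulling back along `θ` is pushing forward along `θ`; invariant
  -- fields thus pull back to invariant fields, and pullback respects brackets.
  have hinv : ∀ g : G, (mfderiv (𝓡 n) (𝓡 n) θ g).inverse = mfderiv (𝓡 n) (𝓡 n) θ (θ g) := by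
    intro g
    have e : (θ ∘ θ : G → G) = id := funext hθ
    have h1 := mfderiv_comp (I := 𝓡 n) (I' := 𝓡 n) (I'' := 𝓡 n) g
      (g := θ) (f := θ) (hd _) (hd g)
    have h2 := mfderiv_comp (I := 𝓡 n) (I' := 𝓡 n) (I'' := 𝓡 n) (θ g)
      (g := θ) (f := θ) (hd _) (hd (θ g))
    rw [e, mfderiv_id] at h1 h2
    rw [hθ] at h2
    exact ContinuousLinearMap.inverse_eq h2.symm h1.symm
  have hpull : ∀ u : GroupLieAlgebra (𝓡 n) G, mpullback (𝓡 n) (𝓡 n) θ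
      (mulInvariantVectorField (lieDifferential n θ.toMonoidHom u)) =
        mulInvariantVectorField u := by
    intro u
    ext g
    have h := mfderiv_mulInvariantVectorField θ.toMonoidHom hd
      (lieDifferential n θ.toMonoidHom u) (θ g)
    rw [lieDifferential_involutive θ hd hθ] at h
    simp only [mpullback, hinv]
    refine h.trans ?_
    exact congrArg (mulInvariantVectorField u) (hθ g)
  have h := mpullback_mlieBracket (I := 𝓡 n) (I' := 𝓡 n) (n := ∞) (f := θ) (x₀ := (1 : G))
    (V := mulInvariantVectorField (lieDifferential n θ.toMonoidHom v))
    (W := mulInvariantVectorField (lieDifferential n θ.toMonoidHom w))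
    (mdifferentiableAt_mulInvariantVectorField _) (mdifferentiableAt_mulInvariantVectorField _)
    (hs 1) (by rw [minSmoothness_of_isRCLikeNormedField]; exact WithTop.coe_le_coe.2 le_top)
  rw [hpull, hpull, mpullback_apply, hinv] at h
  rw [map_one] at h
  have h' := congrArg (lieDifferential n θ.toMonoidHom) h
  have h'' : lieDifferential n θ.toMonoidHom (lieDifferential n θ.toMonoidHom
    ⁅lieDifferential n θ.toMonoidHom v, lieDifferential n θ.toMonoidHom w⁆) =
      lieDifferential n θ.toMonoidHom ⁅v, w⁆ := h'
  rw [← h'', lieDifferential_involutive θ hd hθ]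

end CartanDecomposition

/-! ### Left-invariant derivatives and the Hessian at the identity -/

section SecondDerivative

variable {n : ℕ} {G : Type*} [TopologicalSpace G] [ChartedSpace (EuclideanSpace ℝ (Fin n)) G]
  [Group G]

/-- The derivative of a function on `G` along a left-invariant vector field. -/
noncomputable def invariantDeriv (φ : G → ℝ) (w : GroupLieAlgebra (𝓡 n) G) (g : G) : ℝ :=
  mfderiv (𝓡 n) 𝓘(ℝ, ℝ) φ g (mulInvariantVectorField w g)

theorem invariantDeriv_add (φ : G → ℝ) (v w : GroupLieAlgebra (𝓡 n) G) :
    invariantDeriv φ (v + w) = invariantDeriv φ v + invariantDeriv φ w := by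
  ext g
  unfold invariantDeriv
  rw [mulInvariantVectorField_add]
  exact map_add _ _ _

theorem invariantDeriv_smul (φ : G → ℝ) (c : ℝ) (v : GroupLieAlgebra (𝓡 n) G) :
    invariantDeriv φ (c • v) = c • invariantDeriv φ v := by
  ext g
  unfold invariantDeriv
  rw [mulInvariantVectorField_smul]
  exact map_smul (mfderiv (𝓡 n) 𝓘(ℝ, ℝ) φ g) c (mulInvariantVectorField v g)

theorem invariantDeriv_one (φ : G → ℝ) (v : GroupLieAlgebra (𝓡 n) G) :
    invariantDeriv φ v 1 = mfderiv (𝓡 n) 𝓘(ℝ, ℝ) φ 1 v := by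
  unfold invariantDeriv
  rw [mulInvariantVectorField_one]

variable [LieGroup (𝓡 n) ∞ G]

theorem mdifferentiable_invariantDeriv {φ : G → ℝ} (hφ : ContMDiff (𝓡 n) 𝓘(ℝ, ℝ) ∞ φ)
    (w : GroupLieAlgebra (𝓡 n) G) : MDifferentiable (𝓡 n) 𝓘(ℝ, ℝ) (invariantDeriv φ w) := by
  have h1 : ContMDiff (𝓡 n).tangent 𝓘(ℝ, ℝ).tangent 1 (tangentMap (𝓡 n) 𝓘(ℝ, ℝ) φ) :=
    (hφ.of_le (m := 2) (WithTop.coe_le_coe.2 le_top)).contMDiff_tangentMap (by norm_num)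
  have h2 := (contMDiff_snd_tangentBundle_modelSpace ℝ 𝓘(ℝ, ℝ)).comp
    (h1.comp (contMDiff_one_mulInvariantVectorField w))
  exact h2.mdifferentiable (by simp)

theorem invariantDeriv_eq_mfderiv_translate {φ : G → ℝ} (hφ : MDifferentiable (𝓡 n) 𝓘(ℝ, ℝ) φ)
    (w : GroupLieAlgebra (𝓡 n) G) (g : G) :
    invariantDeriv φ w g = mfderiv (𝓡 n) 𝓘(ℝ, ℝ) (fun h => φ (g * h)) 1 w := by
  have := mfderiv_comp_apply (I := 𝓡 n) (I' := 𝓡 n) (I'' := 𝓘(ℝ, ℝ)) (1 : G)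
    (g := φ) (f := (g * ·)) (hφ _) (mdifferentiable_leftTranslation g 1) w
  rw [mul_one] at this
  exact this.symm

variable [T2Space G]

/-- Derivative of a function along a one-parameter group. -/
theorem hasDerivAt_comp_lieExp {φ : G → ℝ} (hφ : MDifferentiable (𝓡 n) 𝓘(ℝ, ℝ) φ)
    (v : GroupLieAlgebra (𝓡 n) G) (t : ℝ) :
    HasDerivAt (fun t : ℝ => φ (lieExp (t • v))) (invariantDeriv φ v (lieExp (t • v))) t := by
  have h := (hφ (lieExp (t • v))).hasMFDerivAt.comp t (isMIntegralCurve_lieExp v t)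
  refine HasFDerivAt.hasDerivAt (f' := ContinuousLinearMap.toSpanSingleton ℝ
    (invariantDeriv φ v (lieExp (t • v)))) ?_ |>.congr_deriv (one_smul ℝ _)
  refine (h.congr_mfderiv ?_).hasFDerivAt
  ext
  exact congrArg (mfderiv (𝓡 n) 𝓘(ℝ, ℝ) φ (lieExp (t • v)))
    (one_smul ℝ (mulInvariantVectorField v (lieExp (t • v) : G))) |>.trans (one_smul ℝ _).symm

/-- The second derivative at `1`, along left-invariant fields. -/
noncomputable def invariantHessian {φ : G → ℝ} (hφ : ContMDiff (𝓡 n) 𝓘(ℝ, ℝ) ∞ φ) :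
    LinearMap.BilinForm ℝ (GroupLieAlgebra (𝓡 n) G) :=
  -- The inner derivative is along `w`, the outer one along `v`. The form need not be symmetric, and
  -- symmetry is never used.
  LinearMap.mk₂ ℝ (fun v w => invariantDeriv (invariantDeriv φ w) v 1)
    (fun v v' w => by rw [invariantDeriv_add]; rfl)
    (fun c v w => by rw [invariantDeriv_smul]; rfl)
    (fun v w w' => by
      simp only [invariantDeriv_add φ w, invariantDeriv_one]
      rw [mfderiv_add (mdifferentiable_invariantDeriv hφ w 1)
          (mdifferentiable_invariantDeriv hφ w' 1)]
      rfl)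
    (fun c v w => by
      rw [invariantDeriv_smul, invariantDeriv_one, invariantDeriv_one,
        const_smul_mfderiv (mdifferentiable_invariantDeriv hφ w 1)]
      rfl)

theorem invariantHessian_apply {φ : G → ℝ} (hφ : ContMDiff (𝓡 n) 𝓘(ℝ, ℝ) ∞ φ)
    (v w : GroupLieAlgebra (𝓡 n) G) :
    invariantHessian hφ v w = deriv (fun t : ℝ => invariantDeriv φ w (lieExp (t • v))) 0 := by
  rw [(hasDerivAt_comp_lieExp (mdifferentiable_invariantDeriv hφ w) v 0).deriv, zero_smul,
    lieExp_zero]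
  rfl

theorem iteratedDeriv_two_comp_lieExp {φ : G → ℝ} (hφ : ContMDiff (𝓡 n) 𝓘(ℝ, ℝ) ∞ φ)
    (v : GroupLieAlgebra (𝓡 n) G) :
    iteratedDeriv 2 (fun t : ℝ => φ (lieExp (t • v))) 0 = invariantHessian hφ v v := by
  rw [iteratedDeriv_succ, iteratedDeriv_one, invariantHessian_apply]
  congr 1
  ext t
  exact (hasDerivAt_comp_lieExp (hφ.mdifferentiable (by simp)) v t).deriv

end SecondDerivative

/-! ### Derived algebras and Killing orthogonality -/

section DerivedSubalgebra

variable {n : ℕ} {G : Type*} [TopologicalSpace G] [ChartedSpace (EuclideanSpace ℝ (Fin n)) G]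
  [Group G] [LieGroup (𝓡 n) ∞ G]

theorem mem_derivedSubalgebra_iff (𝔥 : LieSubalgebra ℝ (GroupLieAlgebra (𝓡 n) G))
    (η : GroupLieAlgebra (𝓡 n) G) :
    η ∈ derivedSubalgebra n 𝔥 ↔
      η ∈ Submodule.span ℝ {ζ | ∃ a ∈ 𝔥, ∃ b ∈ 𝔥, ⁅a, b⁆ = ζ} := by
  have e : (LieAlgebra.derivedSeries ℝ 𝔥 1).toSubmodule =
      Submodule.span ℝ {ζ | ∃ a b : 𝔥, ⁅a, b⁆ = ζ} := by
    rw [LieAlgebra.derivedSeries_def, LieAlgebra.derivedSeriesOfIdeal_succ,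
      LieAlgebra.derivedSeriesOfIdeal_zero, LieSubmodule.lieIdeal_oper_eq_linear_span']
    simp
  have h : η ∈ derivedSubalgebra n 𝔥 ↔
      η ∈ (LieAlgebra.derivedSeries ℝ 𝔥 1).toSubmodule.map (𝔥.incl : 𝔥 →ₗ[ℝ] _) := by
    simp only [derivedSubalgebra, LieSubalgebra.mem_map, Submodule.mem_map]
    rfl
  rw [h, e, Submodule.map_span]
  have e' : ((𝔥.incl : 𝔥 →ₗ[ℝ] GroupLieAlgebra (𝓡 n) G) '' {ζ | ∃ a b : 𝔥, ⁅a, b⁆ = ζ}) =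
      {ζ | ∃ a ∈ 𝔥, ∃ b ∈ 𝔥, ⁅a, b⁆ = ζ} := by
    ext ζ
    constructor
    · rintro ⟨_, ⟨a, b, rfl⟩, rfl⟩
      exact ⟨a, a.2, b, b.2, rfl⟩
    · rintro ⟨a, ha, b, hb, rfl⟩
      exact ⟨_, ⟨⟨a, ha⟩, ⟨b, hb⟩, rfl⟩, rfl⟩
  rw [e']

theorem derivedSubalgebra_le (𝔥 : LieSubalgebra ℝ (GroupLieAlgebra (𝓡 n) G)) :
    derivedSubalgebra n 𝔥 ≤ 𝔥 := by
  intro η hη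
  rw [mem_derivedSubalgebra_iff] at hη
  have : Submodule.span ℝ {ζ | ∃ a ∈ 𝔥, ∃ b ∈ 𝔥, ⁅a, b⁆ = ζ} ≤ 𝔥.toSubmodule := by
    rw [Submodule.span_le]
    rintro _ ⟨a, ha, b, hb, rfl⟩
    exact 𝔥.lie_mem ha hb
  exact this hη

theorem derivedSubalgebra_le_derivedSeries (𝔥 : LieSubalgebra ℝ (GroupLieAlgebra (𝓡 n) G))
    {η : GroupLieAlgebra (𝓡 n) G} (hη : η ∈ derivedSubalgebra n 𝔥) :
    η ∈ LieAlgebra.derivedSeries ℝ (GroupLieAlgebra (𝓡 n) G) 1 := by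
  rw [mem_derivedSubalgebra_iff] at hη
  have : Submodule.span ℝ {ζ | ∃ a ∈ 𝔥, ∃ b ∈ 𝔥, ⁅a, b⁆ = ζ} ≤
      (LieAlgebra.derivedSeries ℝ (GroupLieAlgebra (𝓡 n) G) 1).toSubmodule := by
    rw [Submodule.span_le]
    rintro _ ⟨a, -, b, -, rfl⟩
    exact LieSubmodule.lie_mem_lie (LieSubmodule.mem_top a) (LieSubmodule.mem_top b)
  exact this hη

/-- A subspace stable under a Lie algebra endomorphism has stable derived algebra. -/
theorem map_mem_derivedSubalgebra {𝔥 : LieSubalgebra ℝ (GroupLieAlgebra (𝓡 n) G)}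
    (σ : GroupLieAlgebra (𝓡 n) G →ₗ[ℝ] GroupLieAlgebra (𝓡 n) G)
    (hσ : ∀ v w, σ ⁅v, w⁆ = ⁅σ v, σ w⁆) (h𝔥 : ∀ v ∈ 𝔥, σ v ∈ 𝔥)
    {η : GroupLieAlgebra (𝓡 n) G} (hη : η ∈ derivedSubalgebra n 𝔥) :
    σ η ∈ derivedSubalgebra n 𝔥 := by
  rw [mem_derivedSubalgebra_iff] at hη ⊢
  have : Submodule.span ℝ {ζ | ∃ a ∈ 𝔥, ∃ b ∈ 𝔥, ⁅a, b⁆ = ζ} ≤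
      (Submodule.span ℝ {ζ | ∃ a ∈ 𝔥, ∃ b ∈ 𝔥, ⁅a, b⁆ = ζ}).comap σ := by
    rw [Submodule.span_le]
    rintro _ ⟨a, ha, b, hb, rfl⟩
    exact Submodule.subset_span ⟨σ a, h𝔥 a ha, σ b, h𝔥 b hb, (hσ a b).symm⟩
  exact this hη

/-- Elements of `𝔞` are Killing-orthogonal to the derived algebra of the centralizer of `𝔞`. -/
theorem killingForm_eq_zero_of_mem_derivedSubalgebra
    {𝔞 : LieSubalgebra ℝ (GroupLieAlgebra (𝓡 n) G)} {ζ η : GroupLieAlgebra (𝓡 n) G}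
    (hζ : ζ ∈ 𝔞) (hη : η ∈ derivedSubalgebra n (algebraCentralizer n 𝔞)) :
    killingForm ℝ (GroupLieAlgebra (𝓡 n) G) ζ η = 0 := by
  rw [mem_derivedSubalgebra_iff] at hη
  have : Submodule.span ℝ {ζ | ∃ a ∈ algebraCentralizer n 𝔞, ∃ b ∈ algebraCentralizer n 𝔞,
      ⁅a, b⁆ = ζ} ≤ LinearMap.ker (killingForm ℝ (GroupLieAlgebra (𝓡 n) G) ζ) := by
    rw [Submodule.span_le]
    rintro _ ⟨a, ha, b, -, rfl⟩
    have h0 : ⁅ζ, a⁆ = 0 := by rw [← lie_skew, ha ζ hζ, neg_zero]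
    -- Invariance of the Killing form: `B(ζ, [a, b]) = B([ζ, a], b)`, and `a` commutes with `ζ`.
    have := LieModule.traceForm_apply_lie_apply ℝ (GroupLieAlgebra (𝓡 n) G)
      (GroupLieAlgebra (𝓡 n) G) ζ a b
    rw [h0, map_zero] at this
    exact this.symm
  exact this hη

end DerivedSubalgebra

/-! ### The Hessian of a Kempf–Ness function and the stabilizer algebra -/

section KempfNess

variable {n : ℕ} {G : Type*} [TopologicalSpace G] [ChartedSpace (EuclideanSpace ℝ (Fin n)) G]
  [Group G] {M : Type*} [TopologicalSpace M] [MulAction G M] {θ : G ≃* G} {Ψ : M → G → ℝ}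

theorem mem_kPart_iff {ξ : GroupLieAlgebra (𝓡 n) G} :
    ξ ∈ kPart n θ ↔ lieDifferential n θ.toMonoidHom ξ = ξ := by
  simp [kPart]

theorem mem_pPart_iff {ξ : GroupLieAlgebra (𝓡 n) G} :
    ξ ∈ pPart n θ ↔ lieDifferential n θ.toMonoidHom ξ = -ξ := by
  simp [pPart]

theorem half_add_mem_kPart (hσ : ∀ ξ : GroupLieAlgebra (𝓡 n) G, lieDifferential n θ.toMonoidHom
      (lieDifferential n θ.toMonoidHom ξ) = ξ) (ξ : GroupLieAlgebra (𝓡 n) G) :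
    (2⁻¹ : ℝ) • (ξ + lieDifferential n θ.toMonoidHom ξ) ∈ kPart n θ := by
  rw [mem_kPart_iff, map_smul, map_add, hσ, add_comm]

theorem half_sub_mem_pPart (hσ : ∀ ξ : GroupLieAlgebra (𝓡 n) G, lieDifferential n θ.toMonoidHom
      (lieDifferential n θ.toMonoidHom ξ) = ξ) (ξ : GroupLieAlgebra (𝓡 n) G) :
    (2⁻¹ : ℝ) • (ξ - lieDifferential n θ.toMonoidHom ξ) ∈ pPart n θ := by
  rw [mem_pPart_iff, map_smul, map_sub, hσ, ← smul_neg, neg_sub]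

theorem half_add_add_half_sub (ξ η : GroupLieAlgebra (𝓡 n) G) :
    (2⁻¹ : ℝ) • (ξ + η) + (2⁻¹ : ℝ) • (ξ - η) = ξ := by
  module

/-- The cocycle identity at a fixed point: translating `φ(h) = Ψ(y, h⁻¹)` by the stabilizer only
adds a constant, so its invariant derivatives at stabilizer points are those at `1`. -/
theorem IsKempfNess.apply_inv_mul (hΨ : IsKempfNess (n := n) θ Ψ) {y : M} {g : G}
    (hg : g ∈ MulAction.stabilizer G y) (h : G) :
    Ψ y (g * h)⁻¹ = Ψ y g⁻¹ + Ψ y h⁻¹ := by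
  have hg' : g⁻¹ • y = y := MulAction.mem_stabilizer_iff.1 (inv_mem hg)
  have := hΨ.cocycle y g⁻¹ h⁻¹
  rw [hg'] at this
  rw [mul_inv_rev, ← this]

variable [LieGroup (𝓡 n) ∞ G]

theorem IsKempfNess.contMDiff_inv (hΨ : IsKempfNess (n := n) θ Ψ) (y : M) :
    ContMDiff (𝓡 n) 𝓘(ℝ, ℝ) ∞ (fun g : G => Ψ y g⁻¹) :=
  (hΨ.smooth y).comp (_root_.contMDiff_inv (𝓡 n) ∞)

variable [T2Space G]

theorem hasDerivAt_translate_lieExp {φ : G → ℝ} (hφ : MDifferentiable (𝓡 n) 𝓘(ℝ, ℝ) φ)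
    (w : GroupLieAlgebra (𝓡 n) G) (g : G) :
    HasDerivAt (fun t : ℝ => φ (g * lieExp (t • w))) (invariantDeriv φ w g) 0 := by
  have h := hasDerivAt_comp_lieExp (φ := fun h => φ (g * h))
    (hφ.comp (mdifferentiable_leftTranslation g)) w 0
  rwa [zero_smul, lieExp_zero, invariantDeriv_one, ← invariantDeriv_eq_mfderiv_translate hφ] at h

theorem lieExp_mem_fixedSubgroup (hθ : MDifferentiable (𝓡 n) (𝓡 n) θ)
    {w : GroupLieAlgebra (𝓡 n) G} (hw : w ∈ kPart n θ) (t : ℝ) :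
    (lieExp (t • w) : G) ∈ fixedSubgroup θ := by
  have := map_lieExp θ.toMonoidHom hθ w t
  rw [mem_kPart_iff.1 hw] at this
  exact this

theorem IsKempfNess.invariantDeriv_kPart (hΨ : IsKempfNess (n := n) θ Ψ)
    (hθ : MDifferentiable (𝓡 n) (𝓡 n) θ) (y : M) {w : GroupLieAlgebra (𝓡 n) G}
    (hw : w ∈ kPart n θ) (g : G) : invariantDeriv (fun g : G => Ψ y g⁻¹) w g = 0 := by
  have h := hasDerivAt_translate_lieExp ((hΨ.contMDiff_inv y).mdifferentiable (by simp)) w g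
  have e : (fun t : ℝ => Ψ y (g * lieExp (t • w))⁻¹) = fun _ => Ψ y g⁻¹ := by
    ext t
    rw [mul_inv_rev, hΨ.left_invariant y _ (inv_mem (lieExp_mem_fixedSubgroup hθ hw t))]
  rw [e] at h
  exact h.unique (hasDerivAt_const _ _)

theorem comp_lieExp_inv_eq (f : G → ℝ) (v : GroupLieAlgebra (𝓡 n) G) :
    (fun t : ℝ => f (lieExp (t • v))⁻¹) = fun t : ℝ => f (lieExp ((-t) • v)) := by
  ext t
  rw [lieExp_neg_smul]

/-- Zeros of the gradient map are critical points of `g ↦ Ψ(y, g⁻¹)` at `1`. -/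
theorem IsKempfNess.invariantDeriv_one_eq_zero (hΨ : IsKempfNess (n := n) θ Ψ)
    (hθ : IsCartanInvolution n θ) {y : M} (hy : ∀ v ∈ pPart n θ, gradientMap n Ψ y v = 0)
    (w : GroupLieAlgebra (𝓡 n) G) : invariantDeriv (fun g : G => Ψ y g⁻¹) w 1 = 0 := by
  have hd : MDifferentiable (𝓡 n) (𝓡 n) θ := hθ.smooth.mdifferentiable (by simp)
  have hσ := lieDifferential_involutive θ hd hθ.involutive
  rw [← half_add_add_half_sub w (lieDifferential n θ.toMonoidHom w), invariantDeriv_add,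
    Pi.add_apply, hΨ.invariantDeriv_kPart hd y (half_add_mem_kPart hσ w), zero_add]
  set v := (2⁻¹ : ℝ) • (w - lieDifferential n θ.toMonoidHom w)
  have h := hasDerivAt_translate_lieExp ((hΨ.contMDiff_inv y).mdifferentiable (by simp)) v 1
  simp only [one_mul] at h
  rw [comp_lieExp_inv_eq (Ψ y)] at h
  rw [← h.deriv, deriv_comp_neg (fun t : ℝ => Ψ y (lieExp (t • v))), neg_zero]
  exact neg_eq_zero.2 (hy v (half_sub_mem_pPart hσ w))

/-- At a zero of the gradient map, the first derivatives of `g ↦ Ψ(y, g⁻¹)` vanish along `K`. -/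
theorem IsKempfNess.invariantDeriv_fixed_eq_zero (hΨ : IsKempfNess (n := n) θ Ψ)
    (hθ : IsCartanInvolution n θ) {y : M} (hy : ∀ v ∈ pPart n θ, gradientMap n Ψ y v = 0)
    (w : GroupLieAlgebra (𝓡 n) G) {k : G} (hk : k ∈ fixedSubgroup θ) :
    invariantDeriv (fun g : G => Ψ y g⁻¹) w k = 0 := by
  have hd := (hΨ.contMDiff_inv y).mdifferentiable (by simp)
  have h := hasDerivAt_translate_lieExp hd w k
  -- Left `K`-invariance allows multiplying `exp(-tw) k⁻¹` by `k` on the left, which yields `exp(-t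
  -- Ad(k) w)` and moves the base point from `k` to `1`.
  have e : (fun t : ℝ => Ψ y (k * lieExp (t • w))⁻¹) =
      fun t : ℝ => Ψ y (1 * lieExp (t • lieAd n k w))⁻¹ := by
    ext t
    have := map_lieExp (MulAut.conj k).toMonoidHom (mdifferentiable_conj k) w t
    rw [one_mul, lieAd, ← this, ← hΨ.left_invariant y k hk]
    congr 1
    simp [mul_assoc]
  rw [e] at h
  exact (h.unique (hasDerivAt_translate_lieExp hd (lieAd n k w) 1)).trans
    (hΨ.invariantDeriv_one_eq_zero hθ hy _)

theorem IsKempfNess.invariantDeriv_stabilizer_eq_zero (hΨ : IsKempfNess (n := n) θ Ψ)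
    (hθ : IsCartanInvolution n θ) {y : M} (hy : ∀ v ∈ pPart n θ, gradientMap n Ψ y v = 0)
    (w : GroupLieAlgebra (𝓡 n) G) {g : G} (hg : g ∈ MulAction.stabilizer G y) :
    invariantDeriv (fun g : G => Ψ y g⁻¹) w g = 0 := by
  have hd := (hΨ.contMDiff_inv y).mdifferentiable (by simp)
  have h := hasDerivAt_translate_lieExp hd w g
  simp only [hΨ.apply_inv_mul hg] at h
  have h' := (hasDerivAt_translate_lieExp hd w 1).const_add (Ψ y g⁻¹)
  simp only [one_mul] at h'
  exact (h.unique h').trans (hΨ.invariantDeriv_one_eq_zero hθ hy _)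

/-- On a one-parameter group inversion is `t ↦ -t`, which leaves second derivatives at `0`
unchanged. -/
theorem IsKempfNess.iteratedDeriv_two_eq_invariantHessian (hΨ : IsKempfNess (n := n) θ Ψ) (y : M)
    (v : GroupLieAlgebra (𝓡 n) G) :
    iteratedDeriv 2 (fun t : ℝ => Ψ y (lieExp (t • v))) 0 =
      invariantHessian (hΨ.contMDiff_inv y) v v := by
  rw [← iteratedDeriv_two_comp_lieExp, comp_lieExp_inv_eq (Ψ y),
    iteratedDeriv_comp_neg 2 (fun t : ℝ => Ψ y (lieExp (t • v)))]
  simp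

theorem IsKempfNess.mem_stabilizerAlgebra_iff (hΨ : IsKempfNess (n := n) θ Ψ) (y : M)
    {v : GroupLieAlgebra (𝓡 n) G} (hv : v ∈ pPart n θ) :
    v ∈ stabilizerAlgebra G y ↔ invariantHessian (hΨ.contMDiff_inv y) v v = 0 := by
  rw [← hΨ.iteratedDeriv_two_eq_invariantHessian]
  exact (hΨ.strict y v hv).symm

/-- At a zero of the gradient map, the `𝔭`-component of an element of the stabilizer algebra lies
in the stabilizer algebra. -/
theorem IsKempfNess.half_sub_mem_stabilizerAlgebra (hΨ : IsKempfNess (n := n) θ Ψ)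
    (hθ : IsCartanInvolution n θ) {y : M} (hy : ∀ v ∈ pPart n θ, gradientMap n Ψ y v = 0)
    {ξ : GroupLieAlgebra (𝓡 n) G} (hξ : ξ ∈ stabilizerAlgebra G y) :
    (2⁻¹ : ℝ) • (ξ - lieDifferential n θ.toMonoidHom ξ) ∈ stabilizerAlgebra G y := by
  have hd : MDifferentiable (𝓡 n) (𝓡 n) θ := hθ.smooth.mdifferentiable (by simp)
  have hσ := lieDifferential_involutive θ hd hθ.involutive
  rw [hΨ.mem_stabilizerAlgebra_iff y (half_sub_mem_pPart hσ ξ)]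
  have hk := half_add_mem_kPart hσ ξ
  have hsum := half_add_add_half_sub ξ (lieDifferential n θ.toMonoidHom ξ)
  set a := (2⁻¹ : ℝ) • (ξ + lieDifferential n θ.toMonoidHom ξ)
  set b := (2⁻¹ : ℝ) • (ξ - lieDifferential n θ.toMonoidHom ξ)
  -- The inner derivative along `a ∈ 𝔨` vanishes on all of `G`.
  have h1 : ∀ v, invariantHessian (hΨ.contMDiff_inv y) v a = 0 := by
    intro v
    rw [invariantHessian_apply]
    simp only [hΨ.invariantDeriv_kPart hd y hk, deriv_const]
  -- Here the outer curve `exp(ta)` stays in `K`, where every first derivative vanishes.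
  have h2 : ∀ w, invariantHessian (hΨ.contMDiff_inv y) a w = 0 := by
    intro w
    rw [invariantHessian_apply]
    simp only [hΨ.invariantDeriv_fixed_eq_zero hθ hy w (lieExp_mem_fixedSubgroup hd hk _),
      deriv_const]
  -- The curve `exp(tξ)` stays in the stabilizer, where first derivatives vanish too. Expanding with
  -- `ξ = a + b` leaves only the value at `(b, b)`.
  have h3 : invariantHessian (hΨ.contMDiff_inv y) ξ ξ = 0 := by
    rw [invariantHessian_apply]
    simp only [hΨ.invariantDeriv_stabilizer_eq_zero hθ hy ξ (hξ _), deriv_const]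
  rw [← hsum, map_add, map_add, LinearMap.add_apply, LinearMap.add_apply, h1, h2, h1] at h3
  simpa using h3

/-- The subspace `𝔭_y` of `𝔭` stabilizing `y`. -/
noncomputable def IsKempfNess.pStabilizer (hΨ : IsKempfNess (n := n) θ Ψ) (y : M) :
    Submodule ℝ (GroupLieAlgebra (𝓡 n) G) where
  carrier := {v | v ∈ pPart n θ ∧ v ∈ stabilizerAlgebra G y}
  zero_mem' := ⟨zero_mem _, (hΨ.mem_stabilizerAlgebra_iff y (zero_mem _)).2 (by simp)⟩
  smul_mem' c v hv := by
    refine ⟨Submodule.smul_mem _ c hv.1, ?_⟩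
    rw [hΨ.mem_stabilizerAlgebra_iff y (Submodule.smul_mem _ c hv.1)]
    simp [(hΨ.mem_stabilizerAlgebra_iff y hv.1).1 hv.2]
  add_mem' {v w} hv hw := by
    have hnonneg : ∀ u ∈ pPart n θ, 0 ≤ invariantHessian (hΨ.contMDiff_inv y) u u :=
      fun u hu => hΨ.iteratedDeriv_two_eq_invariantHessian y u ▸ hΨ.convex y u hu 0
    refine ⟨add_mem hv.1 hw.1, (hΨ.mem_stabilizerAlgebra_iff y (add_mem hv.1 hw.1)).2 ?_⟩
    -- For isotropic `v`, `w` the values at `v + w` and `v - w` are opposite, and both are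
    -- nonnegative.
    have h1 := hnonneg _ (add_mem hv.1 hw.1)
    have h2 := hnonneg _ (sub_mem hv.1 hw.1)
    have hv' := (hΨ.mem_stabilizerAlgebra_iff y hv.1).1 hv.2
    have hw' := (hΨ.mem_stabilizerAlgebra_iff y hw.1).1 hw.2
    simp only [map_add, map_sub, LinearMap.add_apply, LinearMap.sub_apply, hv', hw'] at h1 h2 ⊢
    linarith

end KempfNess

/-! ### Maximal abelian subalgebras inside a subspace -/

section MaximalAbelian

variable {L : Type*} [LieRing L] [LieAlgebra ℝ L]

/-- A subspace of a finite-dimensional Lie algebra contains an abelian subalgebra which contains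
every element of the subspace commuting with it. -/
theorem exists_maximal_abelian [FiniteDimensional ℝ L] (W : Submodule ℝ L) :
    ∃ 𝔞 : LieSubalgebra ℝ L, IsLieAbelian 𝔞 ∧ (∀ ξ ∈ 𝔞, ξ ∈ W) ∧
      ∀ v ∈ W, (∀ ξ ∈ 𝔞, ⁅v, ξ⁆ = 0) → v ∈ 𝔞 := by
  let S : Set (Submodule ℝ L) := {A | A ≤ W ∧ ∀ a ∈ A, ∀ b ∈ A, ⁅a, b⁆ = 0}
  obtain ⟨A, hA, hmax⟩ := WellFounded.has_min (wellFounded_gt (α := Submodule ℝ L)) S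
    ⟨⊥, bot_le, by simp⟩
  refine ⟨{ A with lie_mem' := fun {a b} ha hb => (hA.2 a ha b hb).symm ▸ A.zero_mem },
    ⟨fun a b => Subtype.ext (hA.2 a a.2 b b.2)⟩, fun ξ hξ => hA.1 hξ, fun v hv hc => ?_⟩
  by_contra hvA
  have hvA' : v ∉ A := hvA
  have hc' : ∀ ξ ∈ A, ⁅v, ξ⁆ = 0 := hc
  -- Adjoining `v` would keep the brackets zero and enlarge `A` strictly.
  refine hmax (A ⊔ Submodule.span ℝ {v}) ⟨sup_le hA.1 (by simpa using hv), ?_⟩ ?_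
  · intro a ha b hb
    obtain ⟨a', ha', x, hx, rfl⟩ := Submodule.mem_sup.1 ha
    obtain ⟨b', hb', z, hz, rfl⟩ := Submodule.mem_sup.1 hb
    obtain ⟨c, rfl⟩ := Submodule.mem_span_singleton.1 hx
    obtain ⟨d, rfl⟩ := Submodule.mem_span_singleton.1 hz
    have h : ⁅a', v⁆ = 0 := by rw [← lie_skew, hc' a' ha', neg_zero]
    simp [hA.2 a' ha' b' hb', hc' b' hb', h]
  · exact lt_of_le_of_ne le_sup_left fun h =>
      hvA' (h ▸ Submodule.mem_sup_right (Submodule.mem_span_singleton_self v))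

end MaximalAbelian

/-! ### Polystability and stability at a zero of the gradient map -/

theorem mainTheorem12 {n : ℕ} {G : Type*} [TopologicalSpace G] [T2Space G]
    [ChartedSpace (EuclideanSpace ℝ (Fin n)) G] [Group G] [LieGroup (𝓡 n) ∞ G]
    (hG : IsRealReductive n G) (θ : G ≃* G) (hθ : IsCartanInvolution n θ)
    {M : Type*} [TopologicalSpace M] [T2Space M] [MulAction G M] [ContinuousSMul G M]
    (Ψ : M → G → ℝ) (hΨ : IsKempfNess (n := n) θ Ψ)
    (x : M) (hx : IsPolystable (n := n) θ Ψ ⊤ ⊤ x) :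
    ∃ (g : G) (𝔞 : LieSubalgebra ℝ (GroupLieAlgebra (𝓡 n) G)),
      IsLieAbelian 𝔞 ∧
      (∀ ξ ∈ 𝔞, ξ ∈ pPart n θ) ∧
      (∀ ξ ∈ 𝔞, ξ ∈ stabilizerAlgebra G (g • x)) ∧
      IsPolystable θ Ψ (groupCentralizer n 𝔞) (algebraCentralizer n 𝔞) (g • x) ∧
      IsStable θ Ψ (analyticSubgroup n (derivedSubalgebra n (algebraCentralizer n 𝔞)))
        (derivedSubalgebra n (algebraCentralizer n 𝔞)) (g • x) := by
  obtain ⟨g, -, hg⟩ := hx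
  have hy : ∀ v ∈ pPart n θ, gradientMap n Ψ (g • x) v = 0 :=
    fun v hv => hg v (LieSubalgebra.mem_top v) hv
  have hd : MDifferentiable (𝓡 n) (𝓡 n) θ := hθ.smooth.mdifferentiable (by simp)
  have hσ := lieDifferential_involutive θ hd hθ.involutive
  have : FiniteDimensional ℝ (GroupLieAlgebra (𝓡 n) G) :=
    inferInstanceAs (FiniteDimensional ℝ (EuclideanSpace ℝ (Fin n)))
  obtain ⟨𝔞, hab, h𝔞, hmax⟩ := exists_maximal_abelian (hΨ.pStabilizer (g • x))
  -- The gradient map already vanishes on all of `𝔭` at `g • x`, so the identity is a witness for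
  -- any subgroup.
  have hpoly : ∀ (H : Subgroup G) (𝔥 : LieSubalgebra ℝ (GroupLieAlgebra (𝓡 n) G)),
      IsPolystable θ Ψ H 𝔥 (g • x) :=
    fun H _ => ⟨1, H.one_mem, fun v _ hv => by rw [one_smul]; exact hy v hv⟩
  refine ⟨g, 𝔞, hab, fun ξ hξ => (h𝔞 ξ hξ).1, fun ξ hξ => (h𝔞 ξ hξ).2, hpoly _ _, hpoly _ _,
    1, Subgroup.one_mem _, fun ξ hξ hξx => ?_⟩
  rw [lieAd_one]
  refine ⟨hξ, ?_⟩
  -- The differential of `θ` is `-1` on `𝔞 ⊆ 𝔭`, so it preserves the centralizer.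
  have hcent : ∀ v ∈ algebraCentralizer n 𝔞,
      lieDifferential n θ.toMonoidHom v ∈ algebraCentralizer n 𝔞 := by
    intro v hv ζ hζ
    have h := lieDifferential_lie θ hθ.smooth hθ.involutive v ζ
    rw [hv ζ hζ, map_zero, mem_pPart_iff.1 (h𝔞 ζ hζ).1, lie_neg] at h
    exact neg_eq_zero.1 h.symm
  have hp := half_sub_mem_pPart hσ ξ
  have hpx := hΨ.half_sub_mem_stabilizerAlgebra hθ hy hξx
  have hpd : (2⁻¹ : ℝ) • (ξ - lieDifferential n θ.toMonoidHom ξ) ∈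
      derivedSubalgebra n (algebraCentralizer n 𝔞) :=
    (derivedSubalgebra n (algebraCentralizer n 𝔞)).smul_mem _ (sub_mem hξ
      (map_mem_derivedSubalgebra _ (lieDifferential_lie θ hθ.smooth hθ.involutive) hcent hξ))
  have hsum := half_add_add_half_sub ξ (lieDifferential n θ.toMonoidHom ξ)
  have hk := half_add_mem_kPart hσ ξ
  set b := (2⁻¹ : ℝ) • (ξ - lieDifferential n θ.toMonoidHom ξ)
  have hb𝔞 : b ∈ 𝔞 := hmax b ⟨hp, hpx⟩ (derivedSubalgebra_le _ hpd)
  have hb : b = 0 := by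
    by_contra hb
    -- With `θ b = -b`, definiteness reads `-B(b, b) < 0`, while `B(b, b) = 0` because `b` lies both
    -- in `𝔞` and in `[𝔤^𝔞, 𝔤^𝔞]`.
    have h := hθ.killing_neg b (derivedSubalgebra_le_derivedSeries _ hpd) hb
    rw [mem_pPart_iff.1 hp, map_neg, killingForm_eq_zero_of_mem_derivedSubalgebra hb𝔞 hpd,
      neg_zero] at h
    exact lt_irrefl _ h
  rw [hb, add_zero] at hsum
  rwa [hsum] at hk
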